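/- Let $k$ be a commutative ring with unit and let $P$ be a finite poset with partial order $\preceq$. Let $A$ be the poset (incidence) algebra of $P$ over $k$, that is, the $k$-algebra with basis the matrix units $e_{ij}$, $i\preceq j$, and let $S\subseteq A$ be the subalgebra spanned by the $e_{ii}$. Let $H^*(A,A)$ be the Hochschild cohomology of $A$ with coefficients in itself, computed from the $k$-multilinear cochains $F:A^n\to A$. Let $\Sigma$ be the nerve of $P$, whose $n$-simplices are the chains $\sigma=(i_0\to i_1\to\dots\to i_n)$ with $i_0\preceq i_1\preceq\dots\preceq i_n$, and let $H^*(\Sigma,k)$ be its simplicial cohomology, computed from all functions on $n$-simplices with coboundary $(\delta f)(\sigma)=\sum_{r}(-1)^r f(\partial_r\sigma)$. Then there is a canonical isomorphism of graded $k$-modules $$H^*(A,A)\;\cong\; H^*(\Sigma,k).$$ Explicitly, for a Hochschild $n$-cochain $F$ let $\lambda_F$ be the simplicial $n$-cochain for which $\lambda_F(i_0\to\dots\to i_n)$ is the coefficient of $e_{i_0i_n}$ in $F(e_{i_0i_1},e_{i_1i_2},\dots,e_{i_{n-1}i_n})$. If $F$ is a cocycle then so is $\lambda_F$, and $[F]\mapsto[\lambda_F]$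 is a well-defined $k$-linear isomorphism $H^n(A,A)\to H^n(\Sigma,k)$ for every $n\ge 0$. Moreover, for every simplicial $n$-cochain $f$ there is exactly one $S$-relative Hochschild $n$-cochain $F$ with $\lambda_F=f$. Here $F$ is $S$-relative if, for all $s\in S$ and $a_1,\dots,a_n\in A$, $F(sa_1,\dots,a_n)=sF(a_1,\dots,a_n)$, $F(a_1,\dots,a_ns)=F(a_1,\dots,a_n)s$, and $F(\dots,a_is,a_{i+1},\dots)=F(\dots,a_i,sa_{i+1},\dots)$ for $1\le i<n$; for $n=0$ it means that the element $F\in A$ commutes with $S$. -/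

import Mathlib

open CategoryTheory
open scoped Simplicial

/-! ### Cohomology of a sequence of linear maps `C 0 → C 1 → C 2 → ⋯` -/

section Cohomology

variable {k : Type*} [CommRing k] {C : ℕ → Type*} [∀ n, AddCommGroup (C n)]
  [∀ n, Module k (C n)]

/-- The coboundaries in degree `n`: zero in degree `0`, the image of the differential above. -/
def coboundaries (d : ∀ n, C n →ₗ[k] C (n + 1)) (n : ℕ) : Submodule k (C n) :=
  match n with
  | 0 => ⊥
  | n + 1 => LinearMap.range (d n)

/-- The `n`-th cohomology module: cocycles modulo coboundaries. -/
abbrev Cohomology (d : ∀ n, C n →ₗ[k] C (n + 1)) (n : ℕ) : Type _ :=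
  LinearMap.ker (d n) ⧸ (coboundaries d n).submoduleOf (LinearMap.ker (d n))

/-- The cohomology class of a cocycle. -/
def cohomologyClass (d : ∀ n, C n →ₗ[k] C (n + 1)) {n : ℕ} (c : C n) (hc : d n c = 0) :
    Cohomology d n :=
  Submodule.Quotient.mk ⟨c, LinearMap.mem_ker.2 hc⟩

end Cohomology

/-! ### Hochschild cohomology of an algebra with coefficients in itself -/

namespace Hochschild

section

variable (k A : Type*) [CommRing k] [Ring A] [Algebra k A]

/-- `C^n(A, A)`: the `k`-multilinear maps `A × ⋯ × A → A` of `n` arguments. -/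
abbrev Cochain (n : ℕ) : Type _ := MultilinearMap k (fun _ : Fin n => A) A

variable {k A}

/-- Changing one of `a₀, …, aₙ` changes exactly one entry of the tuple
`(a₀, …, a_j a_{j+1}, …, aₙ)`, and it does so linearly. -/
theorem contractNth_update {n : ℕ} [DecidableEq (Fin (n + 1))] (j : Fin n) (a : Fin (n + 1) → A)
    (i : Fin (n + 1)) :
    ∃ (p : Fin n) (L : A →ₗ[k] A), ∀ x : A,
      Fin.contractNth j.castSucc (· * ·) (Function.update a i x) =
        Function.update (Fin.contractNth j.castSucc (· * ·) a) p (L x) := by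
  rcases lt_trichotomy (i : ℕ) (j : ℕ) with h | h | h
  · refine ⟨⟨i, by omega⟩, LinearMap.id, fun x => ?_⟩
    ext q
    simp only [Fin.contractNth, Function.update_apply, Fin.ext_iff, Fin.val_castSucc, Fin.val_succ,
      LinearMap.id_apply]
    split_ifs <;> first | rfl | omega
  · refine ⟨j, LinearMap.mulRight k (a j.succ), fun x => ?_⟩
    ext q
    simp only [Fin.contractNth, Function.update_apply, Fin.ext_iff, Fin.val_castSucc, Fin.val_succ,
      LinearMap.mulRight_apply]
    split_ifs <;>
      first | rfl | omega | (have hq : q = j := Fin.ext (by assumption)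
                             rw [hq])
  · by_cases h' : (i : ℕ) = j + 1
    · refine ⟨j, LinearMap.mulLeft k (a j.castSucc), fun x => ?_⟩
      ext q
      simp only [Fin.contractNth, Function.update_apply, Fin.ext_iff, Fin.val_castSucc,
        Fin.val_succ, LinearMap.mulLeft_apply]
      split_ifs <;>
        first | rfl | omega | (have hq : q = j := Fin.ext (by assumption)
                               rw [hq])
    · refine ⟨⟨i - 1, by omega⟩, LinearMap.id, fun x => ?_⟩
      ext q
      simp only [Fin.contractNth, Function.update_apply, Fin.ext_iff, Fin.val_castSucc,
        Fin.val_succ, LinearMap.id_apply]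
      split_ifs <;> first | rfl | omega

/-- The cochain `(a₀, …, aₙ) ↦ F(a₀, …, a_j a_{j+1}, …, aₙ)`. -/
def contract {n : ℕ} (j : Fin n) (F : Cochain k A n) : Cochain k A (n + 1) where
  toFun a := F (Fin.contractNth j.castSucc (· * ·) a)
  map_update_add' a i x y := by
    obtain ⟨p, L, h⟩ := contractNth_update (k := k) j a i
    simp only [h, map_add, F.map_update_add]
  map_update_smul' a i c x := by
    obtain ⟨p, L, h⟩ := contractNth_update (k := k) j a i
    simp only [h, map_smul, F.map_update_smul]

/-- The cochain `(a₀, …, aₙ) ↦ a₀ F(a₁, …, aₙ)`. -/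
def mulFirst {n : ℕ} (F : Cochain k A n) : Cochain k A (n + 1) :=
  MultilinearMap.mk' (fun a => a 0 * F (Fin.tail a))
    (fun a i x y => by cases i using Fin.cases <;> simp [Ne.symm, add_mul, mul_add])
    (fun a i c x => by cases i using Fin.cases <;> simp [Ne.symm])

/-- The cochain `(a₀, …, aₙ) ↦ F(a₀, …, aₙ₋₁) aₙ`. -/
def mulLast {n : ℕ} (F : Cochain k A n) : Cochain k A (n + 1) :=
  MultilinearMap.mk' (fun a => F (Fin.init a) * a (Fin.last n))
    (fun a i x y => by
      cases i using Fin.lastCases <;> simp [Ne.symm, Fin.castSucc_ne_last, add_mul, mul_add])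
    (fun a i c x => by
      cases i using Fin.lastCases <;> simp [Ne.symm, Fin.castSucc_ne_last])

variable (k A) in
/-- The Hochschild coboundary
`(δF)(a₀, …, aₙ) = a₀ F(a₁, …, aₙ) + ∑ⱼ (-1)ʲ⁺¹ F(…, a_j a_{j+1}, …)
  + (-1)ⁿ⁺¹ F(a₀, …, aₙ₋₁) aₙ`. -/
def delta (n : ℕ) : Cochain k A n →ₗ[k] Cochain k A (n + 1) where
  toFun F := mulFirst F + ∑ j : Fin n, (-1 : k) ^ ((j : ℕ) + 1) • contract j F
    + (-1 : k) ^ (n + 1) • mulLast F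
  map_add' F G := by
    ext a
    simp [mulFirst, mulLast, contract, mul_add, add_mul, Finset.sum_add_distrib]
    abel
  map_smul' c F := by
    ext a
    simp [mulFirst, mulLast, contract, Finset.smul_sum, smul_comm c]

variable (k A) in
/-- The Hochschild cohomology `H^n(A, A)`. -/
abbrev HH (n : ℕ) : Type _ := Cohomology (delta k A) n

/-- A cochain `F` is `S`-relative if it is `S`-balanced in consecutive arguments and `S`-linear on
both sides. In degree `0` this says that the element `F()` of `A` commutes with `S`. -/
def IsRelative (S : Subalgebra k A) {n : ℕ} (F : Cochain k A n) : Prop :=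
  match n, F with
  | 0, F => ∀ s ∈ S, s * F ![] = F ![] * s
  | n + 1, F => ∀ s ∈ S, ∀ a : Fin (n + 1) → A,
      F (Function.update a 0 (s * a 0)) = s * F a ∧
      F (Function.update a (Fin.last n) (a (Fin.last n) * s)) = F a * s ∧
      ∀ i : Fin n, F (Function.update a i.castSucc (a i.castSucc * s)) =
        F (Function.update a i.succ (s * a i.succ))

end

end Hochschild

/-! ### Cohomology of a simplicial set -/

namespace SimplicialCohomology

variable (k : Type*) [CommRing k] (X : SSet)

/-- The simplicial `n`-cochains of `X` with coefficients in `k`. -/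
abbrev Cochain (n : ℕ) : Type _ := X _⦋n⦌ → k

/-- The simplicial coboundary `(δf)(σ) = ∑ᵣ (-1)ʳ f(∂ᵣσ)`. -/
def delta (n : ℕ) : Cochain k X n →ₗ[k] Cochain k X (n + 1) where
  toFun f σ := ∑ r : Fin (n + 2), (-1 : k) ^ (r : ℕ) * f (X.δ r σ)
  map_add' f g := by
    ext σ
    simp [mul_add, Finset.sum_add_distrib]
  map_smul' c f := by
    ext σ
    simp [Finset.mul_sum, mul_left_comm]

/-- The simplicial cohomology `H^n(X, k)`. -/
abbrev H (n : ℕ) : Type _ := Cohomology (delta k X) n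

end SimplicialCohomology

/-! ### The algebra of a finite poset -/

namespace PosetAlgebra

variable (k : Type*) [CommRing k] {P : Type*} [PartialOrder P] [DecidableEq P]

/-- The matrix unit `e_{ij}` of the incidence algebra, for `i ≤ j`. -/
def matrixUnit (i j : P) (h : i ≤ j) : IncidenceAlgebra k P where
  toFun a b := if a = i ∧ b = j then 1 else 0
  eq_zero_of_not_le' a b hab := if_neg (by rintro ⟨rfl, rfl⟩; exact hab h)

variable (P) in
/-- The subalgebra `S` of diagonal elements, i.e. the span of the `e_{ii}` when `P` is finite. -/
def diagonal [LocallyFiniteOrder P] : Subalgebra k (IncidenceAlgebra k P) where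
  carrier := {f | ∀ i j, i ≠ j → f i j = 0}
  mul_mem' {f g} hf hg i j hij := by
    rw [IncidenceAlgebra.mul_apply]
    refine Finset.sum_eq_zero fun x _ => ?_
    by_cases hx : i = x
    · subst hx
      rw [hg _ _ hij, mul_zero]
    · rw [hf _ _ hx, zero_mul]
  add_mem' {f g} hf hg i j hij := by
    rw [IncidenceAlgebra.add_apply, hf _ _ hij, hg _ _ hij, add_zero]
  algebraMap_mem' c i j hij := by
    rw [Algebra.algebraMap_eq_smul_one, IncidenceAlgebra.constSMul_apply,
      IncidenceAlgebra.one_apply, if_neg hij, smul_zero]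

variable {k}

/-- The simplicial cochain `λ` on the nerve of `P` attached to a Hochschild cochain `F`: for
`σ = (i₀ → i₁ → ⋯ → iₙ)`, `λ(σ)` is the coefficient of `e_{i₀iₙ}` in
`F(e_{i₀i₁}, …, e_{iₙ₋₁iₙ})`. -/
def coefficients [LocallyFiniteOrder P] {n : ℕ}
    (F : Hochschild.Cochain k (IncidenceAlgebra k P) n) :
    SimplicialCohomology.Cochain k (nerve P) n :=
  fun σ : ComposableArrows P n =>
    F (fun j : Fin n => matrixUnit k (σ.obj j.castSucc) (σ.obj j.succ)
      (leOfHom (σ.map (homOfLE (Fin.castSucc_le_succ j))))) (σ.obj 0) (σ.obj (Fin.last n))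

end PosetAlgebra

/-!
The incidence algebra has the matrix units `e_{xy}`, `x ≤ y`, as a basis, so a Hochschild
`n`-cochain `F` amounts to its coefficients: that of `e_{y₀x_{n+1}}` in `F(e_{x₁y₁}, …, e_{xₙyₙ})`,
for all choices of indices. These are arranged as a function of the *junctions*
`(y₀, x₁), (y₁, x₂), …, (yₙ, x_{n+1})` (`coord`). Since a product of matrix units vanishes unless
the junction between them is diagonal, the Hochschild differential becomes the alternating sum over the
deletions of the diagonal junctions (`coord_delta`), the outer two terms included.

Sequences of diagonal junctions are the simplices of the nerve, and `F ↦ λ_F` is the restriction of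
the coordinates to them; there the differential is the simplicial one, whence `λ` is a chain map
(`coefficients_delta`). The relative cochains are those whose coordinates vanish at all other
sequences (`coord_eq_zero_of_isRelative`, `isRelative_ofCoord`). They therefore correspond
bijectively to simplicial cochains, and they form a subcomplex (`delta_relativeCochain`), which
gives surjectivity on cohomology.

For injectivity, the kernel of `λ` is acyclic. Given a sequence whose first nondiagonal junction is
`(y, x)`, insert the diagonal junction `(y, y)` just before it. Evaluating `δF = 0` at the longer
sequence expresses the coordinate of `F` at the original one as a coordinate of the coboundary of
`homotopy (coord F)` (`coord_eq_of_cocycle`).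
-/

namespace PosetAlgebra

/-! ### Matrix units -/

section MatrixUnits

variable (k : Type*) [CommRing k] {P : Type*} [PartialOrder P] [DecidableEq P]

open Classical in
/-- The matrix unit `e_{xy}` of the incidence algebra, taken to be `0` when `x ≤ y` fails. -/
noncomputable def unitOrZero (x y : P) : IncidenceAlgebra k P :=
  if h : x ≤ y then matrixUnit k x y h else 0

variable {k}

theorem matrixUnit_apply (x y : P) (h : x ≤ y) (u v : P) :
    matrixUnit k x y h u v = if u = x ∧ v = y then 1 else 0 := rfl

theorem unitOrZero_of_le {x y : P} (h : x ≤ y) : unitOrZero k x y = matrixUnit k x y h :=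
  dif_pos h

theorem unitOrZero_of_not_le {x y : P} (h : ¬ x ≤ y) : unitOrZero k x y = 0 :=
  dif_neg h

theorem unitOrZero_apply {x y : P} (h : x ≤ y) (u v : P) :
    unitOrZero k x y u v = if u = x ∧ v = y then 1 else 0 := by
  rw [unitOrZero_of_le h, matrixUnit_apply]

variable [LocallyFiniteOrder P]

theorem unitOrZero_mul_apply {x y : P} (h : x ≤ y) (a : IncidenceAlgebra k P) (u v : P) :
    (unitOrZero k x y * a) u v = if u = x then a y v else 0 := by
  simp only [IncidenceAlgebra.mul_apply, unitOrZero_apply h]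
  split_ifs with hu
  · subst hu
    by_cases hv : y ≤ v
    · rw [Finset.sum_eq_single y] <;> simp +contextual [h, hv]
    · rw [IncidenceAlgebra.apply_eq_zero_of_not_le hv]
      refine Finset.sum_eq_zero fun z hz => ?_
      rw [if_neg, zero_mul]
      rintro ⟨-, rfl⟩
      exact hv (Finset.mem_Icc.1 hz).2
  · simp [hu]

theorem mul_unitOrZero_apply {x y : P} (h : x ≤ y) (a : IncidenceAlgebra k P) (u v : P) :
    (a * unitOrZero k x y) u v = if v = y then a u x else 0 := by
  simp only [IncidenceAlgebra.mul_apply, unitOrZero_apply h]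
  split_ifs with hu
  · subst hu
    by_cases hv : u ≤ x
    · rw [Finset.sum_eq_single x] <;> simp +contextual [h, hv]
    · rw [IncidenceAlgebra.apply_eq_zero_of_not_le hv]
      refine Finset.sum_eq_zero fun z hz => ?_
      rw [if_neg, mul_zero]
      rintro ⟨rfl, -⟩
      exact hv (Finset.mem_Icc.1 hz).1
  · simp [hu]

theorem unitOrZero_mul_unitOrZero {x y z : P} (hxy : x ≤ y) (hyz : y ≤ z) :
    unitOrZero k x y * unitOrZero k y z = unitOrZero k x z := by
  ext u v
  rw [unitOrZero_mul_apply hxy, unitOrZero_apply hyz, unitOrZero_apply (hxy.trans hyz)]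
  simp [ite_and]

theorem unitOrZero_mul_of_ne {x y y' z : P} (h : y ≠ y') :
    unitOrZero k x y * unitOrZero k y' z = 0 := by
  by_cases hxy : x ≤ y
  · by_cases hyz : y' ≤ z
    · ext u v
      rw [unitOrZero_mul_apply hxy, unitOrZero_apply hyz]
      simp [h]
    · rw [unitOrZero_of_not_le hyz, mul_zero]
  · rw [unitOrZero_of_not_le hxy, zero_mul]

theorem unitOrZero_mul_self_right (x y : P) :
    unitOrZero k x y * unitOrZero k y y = unitOrZero k x y := by
  by_cases hxy : x ≤ y
  · exact unitOrZero_mul_unitOrZero hxy le_rfl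
  · rw [unitOrZero_of_not_le hxy, zero_mul]

theorem unitOrZero_self_mem_diagonal (x : P) : unitOrZero k x x ∈ diagonal k P := by
  intro i j hij
  rw [unitOrZero_apply le_rfl, if_neg]
  rintro ⟨rfl, rfl⟩
  exact hij rfl

theorem mul_apply_of_mem_diagonal_left {s : IncidenceAlgebra k P} (hs : s ∈ diagonal k P)
    (a : IncidenceAlgebra k P) (u v : P) : (s * a) u v = s u u * a u v := by
  by_cases huv : u ≤ v
  · rw [IncidenceAlgebra.mul_apply, Finset.sum_eq_single u]
    · intro z _ hz
      rw [hs _ _ hz.symm, zero_mul]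
    · simp [huv]
  · simp [IncidenceAlgebra.apply_eq_zero_of_not_le huv]

theorem mul_apply_of_mem_diagonal_right {s : IncidenceAlgebra k P} (hs : s ∈ diagonal k P)
    (a : IncidenceAlgebra k P) (u v : P) : (a * s) u v = a u v * s v v := by
  by_cases huv : u ≤ v
  · rw [IncidenceAlgebra.mul_apply, Finset.sum_eq_single v]
    · intro z _ hz
      rw [hs _ _ hz, mul_zero]
    · simp [huv]
  · simp [IncidenceAlgebra.apply_eq_zero_of_not_le huv]

/-- Matrix units span the incidence algebra, so multilinear maps are determined on them. -/
theorem cochain_ext [Finite P] {n : ℕ} {F G : Hochschild.Cochain k (IncidenceAlgebra k P) n}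
    (h : ∀ v : Fin n → P × P, F (fun j => unitOrZero k (v j).1 (v j).2) =
      G fun j => unitOrZero k (v j).1 (v j).2) :
    F = G := by
  cases nonempty_fintype P
  let b : Module.Basis {v : P × P // v.1 ≤ v.2} k (IncidenceAlgebra k P) :=
    Module.Basis.ofEquivFun
      { toFun a v := a v.1.1 v.1.2
        map_add' _ _ := rfl
        map_smul' _ _ := rfl
        invFun c := 
          { toFun x y := open Classical in if h : x ≤ y then c ⟨(x, y), h⟩ else 0
            eq_zero_of_not_le' x y h := dif_neg h }
        left_inv a := by
          ext x y h
          exact dif_pos h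
        right_inv c := by
          ext v
          exact dif_pos v.2 }
  have hb (v : {v : P × P // v.1 ≤ v.2}) : b v = unitOrZero k v.1.1 v.1.2 := by
    apply b.equivFun.injective
    ext w
    rw [Module.Basis.equivFun_self]
    change _ = unitOrZero k v.1.1 v.1.2 w.1.1 w.1.2
    rw [unitOrZero_apply v.2]
    simp only [Subtype.ext_iff, Prod.ext_iff, eq_comm]
  refine Module.Basis.ext_multilinear (fun _ => b) fun v => ?_
  simp only [hb]
  exact h fun j => (v j).1

end MatrixUnits

/-! ### Coordinates of Hochschild cochains -/

section Coordinates

variable {k : Type*} [CommRing k] {P : Type*} [PartialOrder P] [DecidableEq P]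
  [LocallyFiniteOrder P]

/-- The coordinates of a cochain `F` of degree `n`. A sequence `p₀, …, pₙ` of pairs
`p_j = (y_j, x_{j+1})` is sent to the coefficient of `e_{y₀ x_{n+1}}` in
`F(e_{x₁y₁}, …, e_{xₙyₙ})`; each pair records one junction between consecutive matrix units, the
outer matrix units of `e_{y₀y₀} F(…) e_{x_{n+1}x_{n+1}}` included. -/
noncomputable def coord {n : ℕ} (F : Hochschild.Cochain k (IncidenceAlgebra k P) n)
    (p : Fin (n + 1) → P × P) : k :=
  F (fun j => unitOrZero k (p j.castSucc).2 (p j.succ).1) (p 0).1 (p (Fin.last n)).2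

/-- The sequences of pairs for which all the matrix units occurring in `coord` exist. -/
def Admissible {n : ℕ} (p : Fin (n + 1) → P × P) : Prop :=
  (p 0).1 ≤ (p (Fin.last n)).2 ∧ ∀ j : Fin n, (p j.castSucc).2 ≤ (p j.succ).1

theorem coord_of_not_admissible {n : ℕ} (F : Hochschild.Cochain k (IncidenceAlgebra k P) n)
    {p : Fin (n + 1) → P × P} (hp : ¬ Admissible p) : coord F p = 0 := by
  by_cases h : (p 0).1 ≤ (p (Fin.last n)).2
  · simp only [Admissible, h, true_and, not_forall] at hp
    obtain ⟨j, hj⟩ := hp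
    rw [coord, F.map_coord_zero j (unitOrZero_of_not_le hj), IncidenceAlgebra.zero_apply]
  · exact IncidenceAlgebra.apply_eq_zero_of_not_le h _

/-- A cochain is determined by its coordinates at admissible sequences. -/
theorem eq_of_coord_eq [Finite P] {n : ℕ} {F G : Hochschild.Cochain k (IncidenceAlgebra k P) n}
    (h : ∀ p, Admissible p → coord F p = coord G p) : F = G := by
  have h' (p) : coord F p = coord G p := by
    by_cases hp : Admissible p
    · exact h p hp
    · rw [coord_of_not_admissible F hp, coord_of_not_admissible G hp]
  refine cochain_ext fun v => ?_
  ext x y -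
  have := h' fun j => (Fin.cases x (fun i => (v i).2) j, Fin.lastCases y (fun i => (v i).1) j)
  simpa [coord] using this

/-- In coordinates, the Hochschild differential is an alternating sum over the deletions of the
diagonal pairs: a product of matrix units vanishes unless the junction is diagonal. -/
theorem coord_delta {n : ℕ} (F : Hochschild.Cochain k (IncidenceAlgebra k P) n)
    {p : Fin (n + 2) → P × P} (hp : Admissible p) :
    coord (Hochschild.delta k _ n F) p =
      ∑ j : Fin (n + 2), (-1 : k) ^ (j : ℕ) *
        if (p j).1 = (p j).2 then coord F (p ∘ j.succAbove) else 0 := by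
  obtain ⟨-, hle⟩ := hp
  set a : Fin (n + 1) → IncidenceAlgebra k P :=
    fun j => unitOrZero k (p j.castSucc).2 (p j.succ).1 with ha
  have first : Hochschild.mulFirst F a (p 0).1 (p (Fin.last (n + 1))).2 =
      if (p 0).1 = (p 0).2 then coord F (p ∘ Fin.succAbove 0) else 0 := by
    change (a 0 * F (Fin.tail a)) _ _ = _
    rw [ha, unitOrZero_mul_apply (hle 0)]
    rfl
  have last : Hochschild.mulLast F a (p 0).1 (p (Fin.last (n + 1))).2 =
      if (p (Fin.last (n + 1))).1 = (p (Fin.last (n + 1))).2 then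
        coord F (p ∘ Fin.succAbove (Fin.last (n + 1))) else 0 := by
    change (F (Fin.init a) * a (Fin.last n)) _ _ = _
    rw [ha, mul_unitOrZero_apply (hle (Fin.last n))]
    simp [coord, Fin.init_def, eq_comm]
  have middle (j : Fin n) : Hochschild.contract j F a (p 0).1 (p (Fin.last (n + 1))).2 =
      if (p j.castSucc.succ).1 = (p j.castSucc.succ).2 then
        coord F (p ∘ Fin.succAbove j.castSucc.succ) else 0 := by
    change F (Fin.contractNth j.castSucc (· * ·) a) _ _ = _
    split_ifs with hj
    · have hc : Fin.contractNth j.castSucc (· * ·) a = fun i =>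
          unitOrZero k (p (j.castSucc.succ.succAbove i.castSucc)).2
            (p (j.castSucc.succ.succAbove i.succ)).1 := by
        funext i
        simp only [Fin.contractNth, Fin.val_castSucc, ha]
        split_ifs with h₁ h₂
        · rw [Fin.succAbove_of_castSucc_lt, Fin.succAbove_of_castSucc_lt] <;>
            first | rfl | (rw [Fin.lt_def]; simp; omega)
        · obtain rfl : i = j := Fin.ext h₂
          rw [Fin.succAbove_of_castSucc_lt _ _ (by rw [Fin.lt_def]; simp),
            Fin.succAbove_of_le_castSucc _ _ (by simp)]
          have h₃ := hle i.castSucc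
          have h₄ := hle i.succ
          change unitOrZero k _ (p i.castSucc.succ).1 * unitOrZero k (p i.castSucc.succ).2 _ = _
          change (p i.castSucc.succ).2 ≤ _ at h₄
          rw [hj] at h₃ ⊢
          exact unitOrZero_mul_unitOrZero h₃ h₄
        · rw [Fin.succAbove_of_le_castSucc, Fin.succAbove_of_le_castSucc] <;>
            first | rfl | (rw [Fin.le_def]; simp; omega)
      rw [hc]
      simp [coord]
    · rw [F.map_coord_zero j, IncidenceAlgebra.zero_apply]
      simp only [Fin.contractNth, Fin.val_castSucc, lt_irrefl, if_false, if_true]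
      exact unitOrZero_mul_of_ne hj
  have expand : coord (Hochschild.delta k _ n F) p =
      Hochschild.mulFirst F a (p 0).1 (p (Fin.last (n + 1))).2 +
        ∑ j : Fin n, (-1 : k) ^ ((j : ℕ) + 1) *
          Hochschild.contract j F a (p 0).1 (p (Fin.last (n + 1))).2 +
        (-1 : k) ^ (n + 1) * Hochschild.mulLast F a (p 0).1 (p (Fin.last (n + 1))).2 := by
    let ev : IncidenceAlgebra k P →+ k :=
      { toFun x := x (p 0).1 (p (Fin.last (n + 1))).2
        map_zero' := rfl
        map_add' _ _ := rfl }
    change ev (Hochschild.delta k _ n F a) = _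
    simp only [Hochschild.delta, LinearMap.coe_mk, AddHom.coe_mk, add_apply,
      sum_apply, map_add, map_sum]
    rfl
  rw [expand, first, last, Fin.sum_univ_succ, Fin.sum_univ_castSucc]
  simp only [middle]
  simp [add_assoc]

end Coordinates

/-! ### The contracting homotopy off the diagonal -/

section Homotopy

variable {k : Type*} [CommRing k] {P : Type*}

/-- The sequence `p` with the diagonal pair `(y, y)` inserted before its entry `p q = (y, x)`. -/
def insertDiagonal {n : ℕ} (q : Fin n) (p : Fin n → P × P) : Fin (n + 1) → P × P :=
  fun r => if r = q.castSucc then ((p q).1, (p q).1) else p (q.predAbove r)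

theorem insertDiagonal_self {n : ℕ} (q : Fin n) (p : Fin n → P × P) :
    insertDiagonal q p q.castSucc = ((p q).1, (p q).1) := if_pos rfl

theorem insertDiagonal_castSucc {n : ℕ} {q r : Fin n} (p : Fin n → P × P) (h : r < q) :
    insertDiagonal q p r.castSucc = p r := by
  rw [insertDiagonal, if_neg (by simpa using h.ne), Fin.predAbove_castSucc_of_le _ _ h.le]

theorem insertDiagonal_castSucc_fst {n : ℕ} {q r : Fin n} (p : Fin n → P × P) (h : r ≤ q) :
    (insertDiagonal q p r.castSucc).1 = (p r).1 := by
  obtain rfl | h := h.eq_or_lt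
  · rw [insertDiagonal_self]
  · rw [insertDiagonal_castSucc p h]

theorem insertDiagonal_succ {n : ℕ} {q r : Fin n} (p : Fin n → P × P) (h : q ≤ r) :
    insertDiagonal q p r.succ = p r := by
  have : r.succ ≠ q.castSucc := by
    rw [Fin.le_def] at h
    rw [Ne, Fin.ext_iff, Fin.val_succ, Fin.val_castSucc]
    omega
  rw [insertDiagonal, if_neg this, Fin.predAbove_succ_of_le _ _ h]

theorem insertDiagonal_succAbove {n : ℕ} (q r : Fin n) (p : Fin n → P × P) :
    insertDiagonal q p (q.castSucc.succAbove r) = p r := by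
  obtain h | h := lt_or_ge r q
  · rw [Fin.succAbove_of_castSucc_lt _ _ (by simpa using h), insertDiagonal_castSucc p h]
  · rw [Fin.succAbove_of_le_castSucc _ _ (by simpa using h), insertDiagonal_succ p h]

theorem _root_.Fin.val_succAbove_eq_ite {n : ℕ} (i : Fin (n + 1)) (j : Fin n) :
    (i.succAbove j : ℕ) = if (j : ℕ) < i then (j : ℕ) else j + 1 := by
  rw [Fin.succAbove, apply_ite Fin.val]
  rfl

theorem insertDiagonal_comp_succAbove {n : ℕ} (q : Fin n) (p : Fin (n + 1) → P × P)
    (i : Fin (n + 1)) :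
    insertDiagonal (i.succAbove q) p ∘ ((i.succAbove q).castSucc.succAbove i).succAbove =
      insertDiagonal q (p ∘ i.succAbove) := by
  funext r
  rw [Function.comp_apply]
  obtain rfl | hr := eq_or_ne r q.castSucc
  · have : ((i.succAbove q).castSucc.succAbove i).succAbove q.castSucc =
        (i.succAbove q).castSucc := by
      ext
      simp only [Fin.val_succAbove_eq_ite, Fin.val_castSucc]
      split_ifs <;> omega
    rw [this, insertDiagonal_self, insertDiagonal_self]
    rfl
  · obtain ⟨r, rfl⟩ := Fin.exists_succAbove_eq hr
    have : ((i.succAbove q).castSucc.succAbove i).succAbove (q.castSucc.succAbove r) =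
        (i.succAbove q).castSucc.succAbove (i.succAbove r) := by
      ext
      simp only [Fin.val_succAbove_eq_ite, Fin.val_castSucc]
      split_ifs <;> omega
    rw [this, insertDiagonal_succAbove, insertDiagonal_succAbove]
    rfl

/-- `p q` is the first entry of `p` that is not diagonal. -/
def IsFirstOff {n : ℕ} (p : Fin n → P × P) (q : Fin n) : Prop :=
  (p q).1 ≠ (p q).2 ∧ ∀ r < q, (p r).1 = (p r).2

theorem IsFirstOff.unique {n : ℕ} {p : Fin n → P × P} {q q' : Fin n} (h : IsFirstOff p q)
    (h' : IsFirstOff p q') : q = q' := by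
  by_contra hne
  obtain hlt | hlt := lt_or_gt_of_ne hne
  · exact h.1 (h'.2 q hlt)
  · exact h'.1 (h.2 q' hlt)

theorem exists_isFirstOff {n : ℕ} {p : Fin n → P × P} (h : ¬ ∀ j, (p j).1 = (p j).2) :
    ∃ q, IsFirstOff p q := by
  classical
  push Not at h
  obtain ⟨q, hq, hmin⟩ := WellFounded.has_min (wellFounded_lt (α := Fin n))
    {q | (p q).1 ≠ (p q).2} h
  exact ⟨q, hq, fun r hr => by_contra fun hr' => hmin r hr' hr⟩

theorem IsFirstOff.delete {n : ℕ} {p : Fin (n + 1) → P × P} {i : Fin (n + 1)} {q : Fin n}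
    (h : IsFirstOff p (i.succAbove q)) : IsFirstOff (p ∘ i.succAbove) q :=
  ⟨h.1, fun _ hr => h.2 _ (Fin.strictMono_succAbove i hr)⟩

open Classical in
/-- The contracting homotopy in coordinates: double the first junction at which two consecutive
matrix units do not match, with a sign; zero at sequences of diagonal pairs. -/
noncomputable def homotopy {n : ℕ} (φ : (Fin (n + 1) → P × P) → k) (p : Fin n → P × P) : k :=
  ∑ q : Fin n, if IsFirstOff p q then (-1 : k) ^ (q : ℕ) * φ (insertDiagonal q p) else 0

theorem homotopy_eq {n : ℕ} (φ : (Fin (n + 1) → P × P) → k) {p : Fin n → P × P} {q : Fin n}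
    (h : IsFirstOff p q) : homotopy φ p = (-1 : k) ^ (q : ℕ) * φ (insertDiagonal q p) := by
  rw [homotopy, Finset.sum_eq_single q (fun r _ hr => if_neg fun h' => hr (h'.unique h))
    (by simp), if_pos h]

theorem homotopy_of_diagonal {n : ℕ} (φ : (Fin (n + 1) → P × P) → k) {p : Fin n → P × P}
    (h : ∀ j, (p j).1 = (p j).2) : homotopy φ p = 0 :=
  Finset.sum_eq_zero fun q _ => if_neg fun hq => hq.1 (h q)

variable [PartialOrder P]

theorem admissible_insertDiagonal_iff {n : ℕ} {q : Fin (n + 1)} {p : Fin (n + 1) → P × P} :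
    Admissible (insertDiagonal q p) ↔ Admissible p := by
  have h0 : (insertDiagonal q p 0).1 = (p 0).1 := insertDiagonal_castSucc_fst p (Fin.zero_le q)
  have hlast : insertDiagonal q p (Fin.last (n + 1)) = p (Fin.last n) :=
    insertDiagonal_succ p (Fin.le_last q)
  simp only [Admissible, h0, hlast]
  refine and_congr_right fun _ => ⟨fun h j => ?_, fun h j => ?_⟩
  · obtain hj | hj := lt_or_ge j.castSucc q
    · have := h j.castSucc
      rwa [insertDiagonal_castSucc p hj, Fin.succ_castSucc,
        insertDiagonal_castSucc_fst p (Fin.castSucc_lt_iff_succ_le.1 hj)] at this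
    · have := h j.succ
      rwa [← Fin.succ_castSucc, insertDiagonal_succ p hj,
        insertDiagonal_succ p (hj.trans j.castSucc_le_succ)] at this
  · obtain hj | rfl | hj := lt_trichotomy j q
    · obtain ⟨i, rfl⟩ := Fin.exists_castSucc_eq.2 (Fin.ne_last_of_lt hj)
      rw [insertDiagonal_castSucc p hj, Fin.succ_castSucc,
        insertDiagonal_castSucc_fst p (Fin.castSucc_lt_iff_succ_le.1 hj)]
      exact h i
    · rw [insertDiagonal_self, insertDiagonal_succ p le_rfl]
    · obtain ⟨i, rfl⟩ := Fin.exists_succ_eq.2 (Fin.ne_zero_of_lt hj)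
      rw [insertDiagonal_succ p hj.le, ← Fin.succ_castSucc,
        insertDiagonal_succ p (Fin.le_castSucc_iff.2 hj)]
      exact h i

variable [DecidableEq P] [LocallyFiniteOrder P]

/-- The coordinates of a cocycle off the diagonal are those of a coboundary: expand `δF = 0` at the
sequence with its first nondiagonal junction doubled. -/
theorem coord_eq_of_cocycle {n : ℕ} {F : Hochschild.Cochain k (IncidenceAlgebra k P) n}
    (hF : Hochschild.delta k _ n F = 0) {p : Fin (n + 1) → P × P} (hp : Admissible p)
    (hoff : ¬ ∀ j, (p j).1 = (p j).2) :
    coord F p = ∑ i : Fin (n + 1), (-1 : k) ^ (i : ℕ) *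
      if (p i).1 = (p i).2 then homotopy (coord F) (p ∘ i.succAbove) else 0 := by
  obtain ⟨q, hq⟩ := exists_isFirstOff hoff
  have key := coord_delta F (admissible_insertDiagonal_iff (q := q).2 hp)
  have hzero : coord (Hochschild.delta k _ n F) (insertDiagonal q p) = 0 := by
    rw [hF]
    rfl
  rw [hzero, Fin.sum_univ_succAbove _ q.castSucc, insertDiagonal_self, if_pos rfl,
    show insertDiagonal q p ∘ q.castSucc.succAbove = p from
      funext fun r => insertDiagonal_succAbove q r p, Fin.val_castSucc] at key
  have term (i : Fin (n + 1)) :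
      ((-1 : k) ^ (q.castSucc.succAbove i : ℕ) *
        if (insertDiagonal q p (q.castSucc.succAbove i)).1 =
            (insertDiagonal q p (q.castSucc.succAbove i)).2 then
          coord F (insertDiagonal q p ∘ (q.castSucc.succAbove i).succAbove) else 0) =
      -((-1 : k) ^ (q : ℕ) * ((-1 : k) ^ (i : ℕ) *
        if (p i).1 = (p i).2 then homotopy (coord F) (p ∘ i.succAbove) else 0)) := by
    rw [insertDiagonal_succAbove]
    split_ifs with hi
    · have hne : q ≠ i := by
        rintro rfl
        exact hq.1 hi
      obtain ⟨q', rfl⟩ := Fin.exists_succAbove_eq hne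
      rw [insertDiagonal_comp_succAbove, homotopy_eq _ hq.delete]
      -- Here `q = i.succAbove q'`. Inserting before `q` shifts `i` when `q < i`, and deleting `i`
      -- shifts `q` when `i < q`; exactly one of the two shifts occurs, whence the minus sign.
      have sign : (-1 : k) ^ (((i.succAbove q').castSucc.succAbove i : Fin (n + 2)) : ℕ) =
          -((-1 : k) ^ ((i.succAbove q' : Fin (n + 1)) : ℕ) *
            ((-1 : k) ^ (i : ℕ) * (-1 : k) ^ (q' : ℕ))) := by
        have hsq : (-1 : k) ^ (q' : ℕ) * (-1 : k) ^ (q' : ℕ) = 1 := by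
          rw [← mul_pow]
          simp
        obtain h | h := lt_or_ge q'.castSucc i
        · rw [Fin.succAbove_of_castSucc_lt i q' h, Fin.succAbove_of_le_castSucc _ _
            (by simpa using h.le)]
          simp only [Fin.val_succ, Fin.val_castSucc, pow_succ]
          linear_combination (-1) ^ (i : ℕ) * hsq
        · rw [Fin.succAbove_of_le_castSucc i q' h, Fin.succAbove_of_castSucc_lt _ _
            (by simpa [Fin.castSucc_lt_succ_iff] using h)]
          simp only [Fin.val_succ, Fin.val_castSucc, pow_succ]
          linear_combination - (-1) ^ (i : ℕ) * hsq
      rw [sign]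
      ring
    · simp
  simp only [term] at key
  rw [Finset.sum_neg_distrib, ← Finset.mul_sum] at key
  have hsq : (-1 : k) ^ (q : ℕ) * (-1 : k) ^ (q : ℕ) = 1 := by
    rw [← mul_pow]
    simp
  set S := ∑ i : Fin (n + 1), (-1 : k) ^ (i : ℕ) *
    if (p i).1 = (p i).2 then homotopy (coord F) (p ∘ i.succAbove) else 0
  linear_combination (-1 : k) ^ (q : ℕ) * (-key) - (coord F p - S) * hsq

end Homotopy

/-! ### Cochains with prescribed coordinates -/

section OfCoord

variable {k : Type*} [CommRing k] {P : Type*} [PartialOrder P] [DecidableEq P]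
  [LocallyFiniteOrder P]

variable (k) in
/-- The coefficient of `e_{xy}` as a linear functional on the incidence algebra. -/
def entry (x y : P) : IncidenceAlgebra k P →ₗ[k] k where
  toFun a := a x y
  map_add' _ _ := rfl
  map_smul' _ _ := rfl

/-- The cochain with prescribed coordinates. -/
noncomputable def ofCoord [Fintype P] {n : ℕ} (φ : (Fin (n + 1) → P × P) → k) :
    Hochschild.Cochain k (IncidenceAlgebra k P) n :=
  ∑ p, φ p • ((MultilinearMap.mkPiAlgebra k (Fin n) k).compLinearMap
    fun j => entry k (p j.castSucc).2 (p j.succ).1).smulRight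
      (unitOrZero k (p 0).1 (p (Fin.last n)).2)

theorem ofCoord_apply [Fintype P] {n : ℕ} (φ : (Fin (n + 1) → P × P) → k)
    (a : Fin n → IncidenceAlgebra k P) (u v : P) :
    ofCoord φ a u v = ∑ p : Fin (n + 1) → P × P,
      φ p * ((∏ j : Fin n, a j (p j.castSucc).2 (p j.succ).1) *
        unitOrZero k (p 0).1 (p (Fin.last n)).2 u v) := by
  change entry k u v (ofCoord φ a) = _
  rw [ofCoord, sum_apply, map_sum]
  refine Finset.sum_congr rfl fun p _ => ?_
  rfl

theorem coord_ofCoord [Fintype P] {n : ℕ} (φ : (Fin (n + 1) → P × P) → k)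
    {p : Fin (n + 1) → P × P} (hp : Admissible p) : coord (ofCoord φ) p = φ p := by
  rw [coord, ofCoord_apply, Finset.sum_eq_single p]
  · simp [unitOrZero_apply hp.1, unitOrZero_apply (hp.2 _)]
  · intro p' _ hne
    contrapose! hne
    replace hne := right_ne_zero_of_mul hne
    have hend := right_ne_zero_of_mul hne
    have hmid (j : Fin n) : unitOrZero k (p j.castSucc).2 (p j.succ).1
        (p' j.castSucc).2 (p' j.succ).1 ≠ 0 := fun h0 =>
      left_ne_zero_of_mul hne (Finset.prod_eq_zero (Finset.mem_univ j) h0)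
    have hle : (p' 0).1 ≤ (p' (Fin.last n)).2 := by
      by_contra h
      exact hend (by rw [unitOrZero_of_not_le h, IncidenceAlgebra.zero_apply])
    rw [unitOrZero_apply hle] at hend
    have hend' := (ite_ne_right_iff.1 hend).1
    have hmid' (j : Fin n) := by
      have := hmid j
      rw [unitOrZero_apply (hp.2 j)] at this
      exact (ite_ne_right_iff.1 this).1
    funext j
    refine Prod.ext ?_ ?_
    · refine Fin.cases hend'.1.symm (fun i => (hmid' i).2) j
    · refine Fin.lastCases hend'.2.symm (fun i => (hmid' i).1) j
  · simp

/-- A cocycle whose coordinates vanish at diagonal sequences is a coboundary. -/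
theorem mem_coboundaries_of_coord_diagonal [Finite P] {n : ℕ}
    {F : Hochschild.Cochain k (IncidenceAlgebra k P) n} (hF : Hochschild.delta k _ n F = 0)
    (hdiag : ∀ p, Admissible p → (∀ j, (p j).1 = (p j).2) → coord F p = 0) :
    F ∈ coboundaries (Hochschild.delta k (IncidenceAlgebra k P)) n := by
  cases nonempty_fintype P
  have key (p) (hp : Admissible p) : coord F p = ∑ i : Fin (n + 1), (-1 : k) ^ (i : ℕ) *
      if (p i).1 = (p i).2 then homotopy (coord F) (p ∘ i.succAbove) else 0 := by
    by_cases h : ∀ j, (p j).1 = (p j).2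
    · rw [hdiag p hp h]
      refine (Finset.sum_eq_zero fun i _ => ?_).symm
      rw [homotopy_of_diagonal (p := p ∘ i.succAbove) _ fun j => h _, ite_self, mul_zero]
    · exact coord_eq_of_cocycle hF hp h
  cases n with
  | zero =>
    refine (Submodule.mem_bot k).2 (eq_of_coord_eq fun p hp => ?_)
    rw [key p hp]
    simp [homotopy, coord]
  | succ n =>
    refine ⟨ofCoord (homotopy (coord F)), eq_of_coord_eq fun p hp => ?_⟩
    rw [coord_delta _ hp, key p hp]
    -- Deleting a pair from `p` need not preserve admissibility, so the coordinates are needed at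
    -- inadmissible sequences too; the homotopy vanishes there, as `coord F` does.
    have h (p : Fin (n + 1) → P × P) :
        coord (ofCoord (homotopy (coord F))) p = homotopy (coord F) p := by
      by_cases hp : Admissible p
      · exact coord_ofCoord _ hp
      · rw [coord_of_not_admissible _ hp, homotopy]
        refine (Finset.sum_eq_zero fun q _ => ?_).symm
        rw [coord_of_not_admissible _ (admissible_insertDiagonal_iff.not.2 hp), mul_zero, ite_self]
    simp only [h]

/-- The coordinates of a relative cochain vanish unless all the pairs are diagonal. -/
theorem coord_eq_zero_of_isRelative {n : ℕ} {F : Hochschild.Cochain k (IncidenceAlgebra k P) n}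
    (hF : Hochschild.IsRelative (diagonal k P) F) {p : Fin (n + 1) → P × P} {j : Fin (n + 1)}
    (hj : (p j).1 ≠ (p j).2) : coord F p = 0 := by
  have hzero : ∀ {x y : P}, (0 : IncidenceAlgebra k P) x y = 0 := rfl
  cases n with
  | zero =>
    obtain rfl : j = 0 := Subsingleton.elim (α := Fin 1) _ _
    have h := hF _ (unitOrZero_self_mem_diagonal (p 0).1)
    have h' := congrArg (fun a : IncidenceAlgebra k P => a (p 0).1 (p 0).2) h
    simp only [unitOrZero_mul_apply le_rfl, mul_unitOrZero_apply le_rfl, if_true,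
      if_neg hj.symm] at h'
    rw [coord, show (fun j : Fin 0 => unitOrZero k (p j.castSucc).2 (p j.succ).1) = ![] from
      Subsingleton.elim _ _]
    exact h'
  | succ n =>
    set a : Fin (n + 1) → IncidenceAlgebra k P :=
      fun j => unitOrZero k (p j.castSucc).2 (p j.succ).1 with ha
    change F a _ _ = 0
    induction j using Fin.cases with
    | zero =>
      have h := (hF _ (unitOrZero_self_mem_diagonal (p 0).1) a).1
      have h' := congrArg (fun b : IncidenceAlgebra k P => b (p 0).1 (p (Fin.last (n + 1))).2) h
      simp only [unitOrZero_mul_apply le_rfl, if_true] at h'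
      rw [← h', F.map_coord_zero 0, hzero]
      rw [Function.update_self]
      exact unitOrZero_mul_of_ne hj
    | succ j =>
      induction j using Fin.lastCases with
      | last =>
        have h := (hF _ (unitOrZero_self_mem_diagonal (p (Fin.last (n + 1))).2) a).2.1
        have h' := congrArg (fun b : IncidenceAlgebra k P => b (p 0).1 (p (Fin.last (n + 1))).2) h
        simp only [mul_unitOrZero_apply le_rfl, if_true] at h'
        rw [← h', F.map_coord_zero (Fin.last n), hzero]
        rw [Function.update_self]
        exact unitOrZero_mul_of_ne hj
      | cast j =>
        have h := (hF _ (unitOrZero_self_mem_diagonal (p j.castSucc.succ).1) a).2.2 j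
        rw [ha, unitOrZero_mul_self_right, Function.update_eq_self] at h
        rw [ha, h, F.map_coord_zero j.succ, hzero]
        rw [Function.update_self]
        exact unitOrZero_mul_of_ne hj

/-- A cochain whose coordinates are concentrated at diagonal sequences is relative. -/
theorem isRelative_ofCoord [Fintype P] {n : ℕ} {φ : (Fin (n + 1) → P × P) → k}
    (hφ : ∀ p j, (p j).1 ≠ (p j).2 → φ p = 0) :
    Hochschild.IsRelative (diagonal k P) (ofCoord φ) := by
  have hunit (x y u v : P) (h : unitOrZero k x y u v ≠ 0) : x = u ∧ y = v := by
    by_cases hxy : x ≤ y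
    · rw [unitOrZero_apply hxy] at h
      obtain ⟨rfl, rfl⟩ := (ite_ne_right_iff.1 h).1
      exact ⟨rfl, rfl⟩
    · rw [unitOrZero_of_not_le hxy] at h
      exact absurd rfl h
  cases n with
  | zero =>
    intro s hs
    ext u v -
    rw [mul_apply_of_mem_diagonal_left hs, mul_apply_of_mem_diagonal_right hs, ofCoord_apply,
      Finset.mul_sum, Finset.sum_mul]
    refine Finset.sum_congr rfl fun p _ => ?_
    by_cases h0 : φ p = 0
    · simp [h0]
    have hp : (p 0).1 = (p 0).2 := by_contra fun h => h0 (hφ p 0 h)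
    by_cases h1 : unitOrZero k (p 0).1 (p (Fin.last 0)).2 u v = 0
    · rw [h1]
      simp
    obtain ⟨rfl, rfl⟩ := hunit _ _ _ _ h1
    change s (p 0).1 (p 0).1 * _ = _ * s (p 0).2 (p 0).2
    rw [hp, mul_comm]
  | succ n =>
    intro s hs a
    have hprod (i : Fin (n + 1)) (b : IncidenceAlgebra k P) (p : Fin (n + 2) → P × P) :
        ∏ j, Function.update a i b j (p j.castSucc).2 (p j.succ).1 =
          b (p i.castSucc).2 (p i.succ).1 *
            ∏ j ∈ Finset.univ.erase i, a j (p j.castSucc).2 (p j.succ).1 := by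
      rw [← Finset.mul_prod_erase _ _ (Finset.mem_univ i), Function.update_self]
      congr 1
      refine Finset.prod_congr rfl fun j hj => ?_
      rw [Function.update_of_ne (Finset.ne_of_mem_erase hj)]
    have hprod' (i : Fin (n + 1)) (p : Fin (n + 2) → P × P) :=
      Finset.mul_prod_erase Finset.univ (fun j => a j (p j.castSucc).2 (p j.succ).1)
        (Finset.mem_univ i)
    refine ⟨?_, ?_, fun i => ?_⟩
    · ext u v -
      rw [mul_apply_of_mem_diagonal_left hs, ofCoord_apply, ofCoord_apply, Finset.mul_sum]
      refine Finset.sum_congr rfl fun p _ => ?_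
      by_cases h0 : φ p = 0
      · simp [h0]
      have hp : (p 0).1 = (p 0).2 := by_contra fun h => h0 (hφ p 0 h)
      by_cases h1 : unitOrZero k (p 0).1 (p (Fin.last (n + 1))).2 u v = 0
      · simp [h1]
      obtain ⟨rfl, rfl⟩ := hunit _ _ _ _ h1
      rw [hprod, ← hprod' 0, mul_apply_of_mem_diagonal_left hs, Fin.castSucc_zero, ← hp]
      ring
    · ext u v -
      rw [mul_apply_of_mem_diagonal_right hs, ofCoord_apply, ofCoord_apply, Finset.sum_mul]
      refine Finset.sum_congr rfl fun p _ => ?_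
      by_cases h0 : φ p = 0
      · simp [h0]
      have hp : (p (Fin.last (n + 1))).1 = (p (Fin.last (n + 1))).2 :=
        by_contra fun h => h0 (hφ p _ h)
      by_cases h1 : unitOrZero k (p 0).1 (p (Fin.last (n + 1))).2 u v = 0
      · simp [h1]
      obtain ⟨rfl, rfl⟩ := hunit _ _ _ _ h1
      rw [hprod, ← hprod' (Fin.last n), mul_apply_of_mem_diagonal_right hs, Fin.succ_last, ← hp]
      ring
    · ext u v -
      rw [ofCoord_apply, ofCoord_apply]
      refine Finset.sum_congr rfl fun p _ => ?_
      by_cases h0 : φ p = 0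
      · simp [h0]
      have hp : (p i.castSucc.succ).1 = (p i.castSucc.succ).2 :=
        by_contra fun h => h0 (hφ p _ h)
      rw [hprod, hprod, mul_apply_of_mem_diagonal_right hs, mul_apply_of_mem_diagonal_left hs,
        hp, Fin.succ_castSucc]
      have h₁ := hprod' i.castSucc p
      have h₂ := hprod' i.succ p
      rw [hp, Fin.succ_castSucc] at h₁
      linear_combination φ p * s (p i.succ.castSucc).2 (p i.succ.castSucc).2 *
        unitOrZero k (p 0).1 (p (Fin.last (n + 1))).2 u v * (h₁ - h₂)

end OfCoord

/-! ### Comparison with the nerve -/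

section Nerve

variable {k : Type*} [CommRing k] {P : Type*} [PartialOrder P]

/-- The sequence of diagonal pairs `(i₀, i₀), …, (iₙ, iₙ)` of a simplex `i₀ → ⋯ → iₙ`. -/
def diagonalPairs {n : ℕ} (σ : ComposableArrows P n) : Fin (n + 1) → P × P :=
  fun j => (σ.obj j, σ.obj j)

theorem admissible_diagonalPairs {n : ℕ} (σ : ComposableArrows P n) :
    Admissible (diagonalPairs σ) :=
  ⟨leOfHom (σ.map (homOfLE (Fin.zero_le _))),
    fun j => leOfHom (σ.map (homOfLE (Fin.castSucc_le_succ j)))⟩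

theorem exists_eq_diagonalPairs {n : ℕ} {p : Fin (n + 1) → P × P} (hp : Admissible p)
    (hdiag : ∀ j, (p j).1 = (p j).2) : ∃ σ : ComposableArrows P n, p = diagonalPairs σ := by
  have hmono : Monotone fun j => (p j).1 :=
    Fin.monotone_iff_le_succ.2 fun j => (hdiag j.castSucc).trans_le (hp.2 j)
  exact ⟨hmono.functor, funext fun j => Prod.ext rfl (hdiag j).symm⟩

theorem diagonalPairs_injective {n : ℕ} :
    Function.Injective (diagonalPairs : ComposableArrows P n → Fin (n + 1) → P × P) :=
  fun σ τ h => nerve.ext_of_isThin (C := P) (n := Opposite.op ⦋n⦌) (x := σ) (y := τ)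
    (funext fun j => congrArg Prod.fst (congrFun h j))

variable [DecidableEq P] [LocallyFiniteOrder P]

theorem coefficients_eq_coord {n : ℕ} (F : Hochschild.Cochain k (IncidenceAlgebra k P) n)
    (σ : ComposableArrows P n) : coefficients F σ = coord F (diagonalPairs σ) := by
  have h : (fun j : Fin n => unitOrZero k (σ.obj j.castSucc) (σ.obj j.succ)) = fun j =>
      matrixUnit k _ _ (leOfHom (σ.map (homOfLE (Fin.castSucc_le_succ j)))) :=
    funext fun j => unitOrZero_of_le _
  simp only [coefficients, coord, diagonalPairs, h]

variable (k P) in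
/-- The map `F ↦ λ_F` on cochains. -/
def coefficientsHom (n : ℕ) : Hochschild.Cochain k (IncidenceAlgebra k P) n →ₗ[k]
    SimplicialCohomology.Cochain k (nerve P) n where
  toFun := coefficients
  map_add' _ _ := rfl
  map_smul' _ _ := rfl

theorem coefficients_delta {n : ℕ} (F : Hochschild.Cochain k (IncidenceAlgebra k P) n) :
    coefficients (Hochschild.delta k _ n F) =
      SimplicialCohomology.delta k (nerve P) n (coefficients F) := by
  funext (σ : ComposableArrows P (n + 1))
  rw [coefficients_eq_coord, coord_delta F (admissible_diagonalPairs σ)]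
  refine Finset.sum_congr rfl fun j _ => ?_
  refine congrArg _ ((if_pos rfl).trans ?_)
  exact (coefficients_eq_coord F ((nerve P).δ j σ)).symm

/-- The relative cochain `F` with `λ_F = f`: its coordinates are the values of `f` at the sequences
of diagonal pairs, and zero elsewhere. -/
noncomputable def relativeCochain [Fintype P] {n : ℕ}
    (f : SimplicialCohomology.Cochain k (nerve P) n) :
    Hochschild.Cochain k (IncidenceAlgebra k P) n :=
  ofCoord (Function.extend (diagonalPairs (P := P) (n := n)) f 0)

theorem coefficients_relativeCochain [Fintype P] {n : ℕ}
    (f : SimplicialCohomology.Cochain k (nerve P) n) : coefficients (relativeCochain f) = f := by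
  funext (σ : ComposableArrows P n)
  rw [coefficients_eq_coord, relativeCochain, coord_ofCoord _ (admissible_diagonalPairs σ)]
  exact diagonalPairs_injective.extend_apply _ _ σ

theorem isRelative_relativeCochain [Fintype P] {n : ℕ}
    (f : SimplicialCohomology.Cochain k (nerve P) n) :
    Hochschild.IsRelative (diagonal k P) (relativeCochain f) := by
  refine isRelative_ofCoord fun p j hj => Function.extend_apply' _ _ _ ?_
  rintro ⟨σ, rfl⟩
  exact hj rfl

/-- A relative cochain is determined by its coefficients. -/
theorem eq_of_coefficients_eq [Finite P] {n : ℕ}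
    {F G : Hochschild.Cochain k (IncidenceAlgebra k P) n}
    (hF : Hochschild.IsRelative (diagonal k P) F) (hG : Hochschild.IsRelative (diagonal k P) G)
    (h : coefficients F = coefficients G) : F = G := by
  refine eq_of_coord_eq fun p hp => ?_
  by_cases hdiag : ∀ j, (p j).1 = (p j).2
  · obtain ⟨σ, rfl⟩ := exists_eq_diagonalPairs hp hdiag
    rw [← coefficients_eq_coord, ← coefficients_eq_coord, h]
  · push Not at hdiag
    obtain ⟨j, hj⟩ := hdiag
    rw [coord_eq_zero_of_isRelative hF hj, coord_eq_zero_of_isRelative hG hj]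

/-- The relative cochains form a subcomplex isomorphic to the simplicial cochains: deleting a
diagonal pair from a sequence with a nondiagonal pair leaves the nondiagonal pair in place. -/
theorem delta_relativeCochain [Fintype P] {n : ℕ}
    (f : SimplicialCohomology.Cochain k (nerve P) n) :
    Hochschild.delta k _ n (relativeCochain f) =
      relativeCochain (SimplicialCohomology.delta k (nerve P) n f) := by
  refine eq_of_coord_eq fun p hp => ?_
  by_cases hdiag : ∀ j, (p j).1 = (p j).2
  · obtain ⟨σ, rfl⟩ := exists_eq_diagonalPairs hp hdiag
    rw [← coefficients_eq_coord, ← coefficients_eq_coord, coefficients_delta,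
      coefficients_relativeCochain, coefficients_relativeCochain]
  · push Not at hdiag
    obtain ⟨j, hj⟩ := hdiag
    rw [coord_delta _ hp, coord_eq_zero_of_isRelative (isRelative_relativeCochain _) hj]
    refine Finset.sum_eq_zero fun i _ => ?_
    split_ifs with hi
    · have hne : j ≠ i := by
        rintro rfl
        exact hj hi
      obtain ⟨j, rfl⟩ := Fin.exists_succAbove_eq hne
      rw [coord_eq_zero_of_isRelative (p := p ∘ i.succAbove) (isRelative_relativeCochain f) hj,
        mul_zero]
    · exact mul_zero _

theorem delta_relativeCochain_eq_zero [Fintype P] {n : ℕ}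
    {f : SimplicialCohomology.Cochain k (nerve P) n}
    (hf : SimplicialCohomology.delta k (nerve P) n f = 0) :
    Hochschild.delta k _ n (relativeCochain f) = 0 := by
  have h0 : Function.extend (diagonalPairs (P := P) (n := n + 1))
      (0 : ComposableArrows P (n + 1) → k) 0 = 0 :=
    Function.extend_zero _
  rw [delta_relativeCochain, hf]
  refine (congrArg ofCoord h0).trans ?_
  simp [ofCoord]

/-- If `λ_F = δg`, then `F` differs from the coboundary of the relative cochain of `g` by a cocycle
with vanishing coefficients, which is itself a coboundary. -/
theorem mem_coboundaries_iff [Finite P] {n : ℕ}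
    {F : Hochschild.Cochain k (IncidenceAlgebra k P) n} (hF : Hochschild.delta k _ n F = 0) :
    F ∈ coboundaries (Hochschild.delta k (IncidenceAlgebra k P)) n ↔
      coefficients F ∈ coboundaries (SimplicialCohomology.delta k (nerve P)) n := by
  cases nonempty_fintype P
  have exact_of_zero {F : Hochschild.Cochain k (IncidenceAlgebra k P) n}
      (hF : Hochschild.delta k _ n F = 0) (h : coefficients F = 0) :
      F ∈ coboundaries (Hochschild.delta k (IncidenceAlgebra k P)) n := by
    refine mem_coboundaries_of_coord_diagonal hF fun p hp hdiag => ?_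
    obtain ⟨σ, rfl⟩ := exists_eq_diagonalPairs hp hdiag
    rw [← coefficients_eq_coord, h]
    rfl
  cases n with
  | zero => 
    refine ⟨fun h => ?_, fun h => exact_of_zero hF h⟩
    obtain rfl : F = 0 := h
    rfl
  | succ n =>
    constructor
    · rintro ⟨G, rfl⟩
      exact ⟨coefficients G, (coefficients_delta G).symm⟩
    · rintro ⟨g, hg⟩
      have hG : coefficients (Hochschild.delta k _ n (relativeCochain g)) = coefficients F := by
        rw [coefficients_delta, coefficients_relativeCochain, hg]
      -- `δg = λ_F` is a simplicial cocycle, so its relative cochain is a Hochschild cocycle.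
      have hcocycle :
          Hochschild.delta k _ _ (Hochschild.delta k _ n (relativeCochain g)) = 0 := by
        rw [delta_relativeCochain, hg]
        refine delta_relativeCochain_eq_zero ?_
        rw [← coefficients_delta, hF]
        rfl
      have hsub := exact_of_zero (F := F - Hochschild.delta k _ n (relativeCochain g))
        (by rw [map_sub, hF, hcocycle, sub_zero])
        (by rw [← sub_eq_zero.2 hG.symm]; rfl)
      simpa using Submodule.add_mem _ hsub ⟨relativeCochain g, rfl⟩

variable (k P) in
/-- The map `F ↦ λ_F` on cocycles. -/
noncomputable def coefficientsCocycles (n : ℕ) :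
    LinearMap.ker (Hochschild.delta k (IncidenceAlgebra k P) n) →ₗ[k]
      LinearMap.ker (SimplicialCohomology.delta k (nerve P) n) :=
  (coefficientsHom k P n).restrict fun F hF => by
    rw [LinearMap.mem_ker] at hF ⊢
    change SimplicialCohomology.delta k (nerve P) n (coefficients F) = 0
    rw [← coefficients_delta, hF]
    rfl

variable (k P) in
/-- The map `[F] ↦ [λ_F]` on cohomology. -/
noncomputable def coefficientsCohomology [Finite P] (n : ℕ) :
    Hochschild.HH k (IncidenceAlgebra k P) n →ₗ[k] SimplicialCohomology.H k (nerve P) n :=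
  Submodule.mapQ _ _ (coefficientsCocycles k P n) fun F hF =>
    (mem_coboundaries_iff (LinearMap.mem_ker.1 F.2)).1 hF

theorem bijective_coefficientsCohomology [Finite P] (n : ℕ) :
    Function.Bijective (coefficientsCohomology k P n) := by
  cases nonempty_fintype P
  constructor
  · rw [injective_iff_map_eq_zero]
    intro c hc
    obtain ⟨F, rfl⟩ := Submodule.Quotient.mk_surjective _ c
    replace hc := (Submodule.Quotient.mk_eq_zero _ (x := coefficientsCocycles k P n F)).1 hc
    rw [Submodule.Quotient.mk_eq_zero]
    exact (mem_coboundaries_iff (LinearMap.mem_ker.1 F.2)).2 hc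
  · intro c
    obtain ⟨⟨f, hf⟩, rfl⟩ := Submodule.Quotient.mk_surjective _ c
    refine ⟨cohomologyClass _ (relativeCochain f)
      (delta_relativeCochain_eq_zero (LinearMap.mem_ker.1 hf)), ?_⟩
    exact congrArg Submodule.Quotient.mk (Subtype.ext (coefficients_relativeCochain f))

end Nerve
end PosetAlgebra

theorem theorem4 (k : Type*) [CommRing k] (P : Type*) [PartialOrder P] [Finite P] [DecidableEq P]
    [LocallyFiniteOrder P] :
    (∃ Φ : (n : ℕ) →
        Hochschild.HH k (IncidenceAlgebra k P) n ≃ₗ[k] SimplicialCohomology.H k (nerve P) n,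
      ∀ (n : ℕ) (F : Hochschild.Cochain k (IncidenceAlgebra k P) n)
        (hF : Hochschild.delta k (IncidenceAlgebra k P) n F = 0),
        ∃ hf : SimplicialCohomology.delta k (nerve P) n (PosetAlgebra.coefficients F) = 0,
          Φ n (cohomologyClass (Hochschild.delta k (IncidenceAlgebra k P)) F hF) =
            cohomologyClass (SimplicialCohomology.delta k (nerve P))
              (PosetAlgebra.coefficients F) hf) ∧
    (∀ (n : ℕ) (f : SimplicialCohomology.Cochain k (nerve P) n),
      ∃! F : Hochschild.Cochain k (IncidenceAlgebra k P) n,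
        Hochschild.IsRelative (PosetAlgebra.diagonal k P) F ∧ PosetAlgebra.coefficients F = f) := by
  refine ⟨⟨fun n => LinearEquiv.ofBijective _
    (PosetAlgebra.bijective_coefficientsCohomology n), fun n F hF => ⟨?_, rfl⟩⟩, fun n f => ?_⟩
  · rw [← PosetAlgebra.coefficients_delta, hF]
    rfl
  · cases nonempty_fintype P
    refine ⟨PosetAlgebra.relativeCochain f, ⟨PosetAlgebra.isRelative_relativeCochain f,
      PosetAlgebra.coefficients_relativeCochain f⟩, fun F hF => ?_⟩
    exact PosetAlgebra.eq_of_coefficients_eq hF.1 (PosetAlgebra.isRelative_relativeCochain f)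
      (hF.2.trans (PosetAlgebra.coefficients_relativeCochain f).symm)
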